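/- A Stone space is a compact, Hausdorff, totally disconnected topological space. A cut of a Stone space $E$ is an unordered partition $E = U \sqcup V$ of $E$ into two disjoint clopen sets; it is non-peripheral if $U$ and $V$ each contain at least two points. Two cuts $U \sqcup V$ and $U' \sqcup V'$ are compatible if at least one of the four intersections $U \cap U'$, $U \cap V'$, $V \cap U'$, $V \cap V'$ is empty. The complex of cuts $\mathscr{C}(E)$ is the simple graph whose vertices are the non-peripheral cuts of $E$, with an edge between two distinct cuts whenever they are compatible. Theorem. Let $E$ and $E'$ be second countable Stone spaces, each with at least four points, and let $\Phi\colon \mathscr{C}(E) \to \mathscr{C}(E')$ be an isomorphism of graphs. Then there exists a homeomorphism $f\colon E \to E'$ which induces $\Phi$, that is, $\Phi(U \sqcup V) = f(U) \sqcup f(V)$ for every non-peripheral cut $U \sqcup V$ of $E$. -/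

import Mathlib

open TopologicalSpace

/-- A cut of `E`: an unordered pair consisting of a clopen set and its complement, i.e. a partition
of `E` into two disjoint clopen sets (one of which may be empty). -/
def Cut (E : Type*) [TopologicalSpace E] : Type _ :=
  {c : Sym2 (Clopens E) // ∃ U : Clopens E, c = s(U, Uᶜ)}

namespace Cut

/-- `U` is one of the two sides of the cut `c`. -/
def IsSide {E : Type*} [TopologicalSpace E] (c : Cut E) (U : Clopens E) : Prop :=
  U ∈ c.1

/-- A cut is non-peripheral if each of its two sides contains at least two points. -/
def IsNonperipheral {E : Type*} [TopologicalSpace E] (c : Cut E) : Prop :=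
  ∀ U : Clopens E, c.IsSide U → (U : Set E).Nontrivial

/-- Two cuts cross if each side of the one meets each side of the other
(the four pairwise intersections are nonempty). -/
def Cross {E : Type*} [TopologicalSpace E] (c d : Cut E) : Prop :=
  ∀ U V : Clopens E, c.IsSide U → d.IsSide V → ((U : Set E) ∩ (V : Set E)).Nonempty

/-- Two cuts are compatible if they do not cross. -/
def Compatible {E : Type*} [TopologicalSpace E] (c d : Cut E) : Prop :=
  ¬ c.Cross d

theorem Cross.symm {E : Type*} [TopologicalSpace E] {c d : Cut E} (h : c.Cross d) :
    d.Cross c := fun U V hU hV => by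
  rw [Set.inter_comm]
  exact h V U hV hU

end Cut

/-- The image of a clopen set under a homeomorphism. -/
def clopenImage {E E' : Type*} [TopologicalSpace E] [TopologicalSpace E'] (f : E ≃ₜ E')
    (U : Clopens E) : Clopens E' :=
  ⟨f '' (U : Set E), f.isClosedMap _ U.isClopen.isClosed, f.isOpenMap _ U.isClopen.isOpen⟩

theorem clopenImage_compl {E E' : Type*} [TopologicalSpace E] [TopologicalSpace E'] (f : E ≃ₜ E')
    (U : Clopens E) : clopenImage f Uᶜ = (clopenImage f U)ᶜ :=
  Clopens.ext (Set.image_compl_eq f.bijective)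

/-- The image of a cut `U ⊔ V` under a homeomorphism `f` is the cut `f(U) ⊔ f(V)`. -/
def Cut.map {E E' : Type*} [TopologicalSpace E] [TopologicalSpace E'] (f : E ≃ₜ E')
    (c : Cut E) : Cut E' :=
  ⟨Sym2.map (clopenImage f) c.1, by
    obtain ⟨U, hU⟩ := c.2
    exact ⟨clopenImage f U, by rw [hU, Sym2.map_mk, clopenImage_compl]⟩⟩

/-- The non-peripheral cuts of `E`. -/
def NonperipheralCut (E : Type*) [TopologicalSpace E] : Type _ :=
  {c : Cut E // c.IsNonperipheral}

/-- The complex of cuts: the simple graph whose vertices are the non-peripheral cuts, with an edge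
between distinct cuts whenever they are compatible. -/
def cutComplex (E : Type*) [TopologicalSpace E] : SimpleGraph (NonperipheralCut E) where
  Adj c d := c ≠ d ∧ c.1.Compatible d.1
  symm := ⟨fun _ _ h => ⟨h.1.symm, fun hx => h.2 hx.symm⟩⟩
  loopless := ⟨fun _ h => h.1 rfl⟩

/-!
Two neighbours of a cut lie on the same side of it if and only if some third neighbour crosses (or
equals) each of them, a property which a graph isomorphism preserves. If `E` has at least five
points, every cut has neighbours, and `Φ` lifts to an order isomorphism `φ` between the sides of
cuts which commutes with complements. Moreover `φ` preserves the emptiness of triple intersections: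
`φ U`, `φ V`, `φ W` have a common point only if `U`, `V`, `W` do. Hence, by compactness, the sides
`φ U` with `x ∈ U` have a common point, which is unique and is taken as the image of `x`.

With four points no two cuts are adjacent, so that `Φ` is an arbitrary bijection. A cut is then
determined by the point which shares a side with a base point `x`; thus `Φ` yields a bijection
between the complements of two base points.
-/

open Set

/-- A side of a non-peripheral cut: a clopen set which, like its complement, has at least two
points. Giving a side amounts to giving an oriented non-peripheral cut. -/
structure Side (E : Type*) [TopologicalSpace E] extends Clopens E where
  nontrivial' : carrier.Nontrivial
  nontrivial_compl' : carrierᶜ.Nontrivial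

namespace Side

section Basic

variable {E : Type*} [TopologicalSpace E] {U V W : Side E}

instance : SetLike (Side E) E where
  coe U := U.carrier
  coe_injective := by
    rintro ⟨U, _, _⟩ ⟨V, _, _⟩ h
    congr
    exact Clopens.ext h

instance : PartialOrder (Side E) := .ofSetLike (Side E) E

instance : Compl (Side E) where
  compl U := ⟨U.toClopensᶜ, U.nontrivial_compl', (compl_compl U.carrier).symm ▸ U.nontrivial'⟩

theorem isClopen (U : Side E) : IsClopen (U : Set E) := U.isClopen'

protected theorem nontrivial (U : Side E) : (U : Set E).Nontrivial := U.nontrivial'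

theorem nontrivial_compl (U : Side E) : (U : Set E)ᶜ.Nontrivial := U.nontrivial_compl'

theorem toClopens_injective : Function.Injective (toClopens (E := E)) := fun _ _ h =>
  SetLike.coe_injective (congrArg Clopens.carrier h)

@[simp] theorem toClopens_compl (U : Side E) : Uᶜ.toClopens = U.toClopensᶜ := rfl

@[simp] theorem coe_compl (U : Side E) : ((Uᶜ : Side E) : Set E) = (U : Set E)ᶜ := rfl

@[simp] theorem mem_compl {x : E} : x ∈ Uᶜ ↔ x ∉ U := Iff.rfl

@[simp] protected theorem compl_compl (U : Side E) : Uᶜᶜ = U :=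
  SetLike.coe_injective (compl_compl (U : Set E))

protected theorem compl_lt_compl_iff : Uᶜ < Vᶜ ↔ V < U := by
  simpa only [← SetLike.coe_ssubset_coe] using!
    compl_lt_compl_iff_lt (x := (V : Set E)) (y := (U : Set E))

protected theorem lt_compl_comm : U < Vᶜ ↔ V < Uᶜ := by
  rw [← Side.compl_lt_compl_iff, Side.compl_compl]

protected theorem compl_lt_comm : Uᶜ < V ↔ Vᶜ < U := by
  rw [← Side.compl_lt_compl_iff, Side.compl_compl]

theorem le_compl_iff_disjoint : U ≤ Vᶜ ↔ Disjoint (U : Set E) V :=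
  subset_compl_iff_disjoint_right

theorem not_lt_compl_of_lt (h : W < U) : ¬ W < Uᶜ := by
  obtain ⟨x, hx⟩ := W.nontrivial.nonempty
  exact fun h' => h'.le hx (h.le hx)

theorem not_compl_lt_of_lt (h : W < U) : ¬ Wᶜ < U := by
  rw [Side.compl_lt_comm]
  simpa only [Side.compl_compl] using not_lt_compl_of_lt (Side.compl_lt_compl_iff.2 h)

theorem two_le_encard (U : Side E) : 2 ≤ (U : Set E).encard := by
  simpa only [one_add_one_eq_two] using
    Order.add_one_le_of_lt (one_lt_encard_iff_nontrivial.2 U.nontrivial)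

theorem encard_add_encard_compl (U : Side E) :
    (U : Set E).encard + ((Uᶜ : Side E) : Set E).encard = ENat.card E := by
  rw [coe_compl, Set.encard_add_encard_compl, encard_univ]

/-- The intersection of two sides, as a side when it has at least two points. -/
def inter (U V : Side E) (h : ((U : Set E) ∩ V).Nontrivial) : Side E :=
  ⟨U.toClopens ⊓ V.toClopens, h, U.nontrivial_compl.mono (compl_subset_compl.2 inter_subset_left)⟩

/-- The cut with sides `U` and `Uᶜ`. -/
def toCut (U : Side E) : NonperipheralCut E :=
  ⟨⟨s(U.toClopens, U.toClopensᶜ), U.toClopens, rfl⟩, by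
    rintro V (hV : V ∈ s(_, _))
    rcases Sym2.mem_iff.1 hV with rfl | rfl
    exacts [U.nontrivial, U.nontrivial_compl]⟩

theorem toCut_eq_toCut_iff : U.toCut = V.toCut ↔ U = V ∨ U = Vᶜ := by
  have h : U.toCut = V.toCut ↔ s(U.toClopens, U.toClopensᶜ) = s(V.toClopens, V.toClopensᶜ) :=
    Subtype.ext_iff.trans Subtype.ext_iff
  rw [h, Sym2.eq_iff, ← toClopens_injective.eq_iff, ← toClopens_injective.eq_iff, toClopens_compl]
  constructor
  · exact Or.imp And.left And.left
  · rintro (h | h) <;> simp [h]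

@[simp] theorem toCut_compl (U : Side E) : Uᶜ.toCut = U.toCut :=
  toCut_eq_toCut_iff.2 (Or.inr rfl)

theorem toCut_surjective : Function.Surjective (toCut (E := E)) := by
  rintro ⟨⟨c, U, rfl⟩, hc⟩
  exact ⟨⟨U, hc U (Sym2.mem_mk_left _ _), hc _ (Sym2.mem_mk_right _ _)⟩, rfl⟩

theorem exists_toCut_eq_and_mem (c : NonperipheralCut E) (x : E) :
    ∃ U : Side E, U.toCut = c ∧ x ∈ U := by
  obtain ⟨U, rfl⟩ := toCut_surjective c
  by_cases hx : x ∈ U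
  · exact ⟨U, rfl, hx⟩
  · exact ⟨Uᶜ, toCut_compl U, hx⟩

theorem toCut_ne_of_lt (h : U < V) : U.toCut ≠ V.toCut := by
  rw [Ne, toCut_eq_toCut_iff]
  rintro (rfl | rfl)
  · exact h.false
  · obtain ⟨x, hx⟩ := V.nontrivial_compl.nonempty
    exact hx (h.le hx)

theorem cross_toCut_iff : U.toCut.1.Cross V.toCut.1 ↔
    ¬ U ≤ V ∧ ¬ U ≤ Vᶜ ∧ ¬ Uᶜ ≤ V ∧ ¬ Uᶜ ≤ Vᶜ := by
  have h : U.toCut.1.Cross V.toCut.1 ↔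
      ∀ A ∈ s(U.toClopens, U.toClopensᶜ), ∀ B ∈ s(V.toClopens, V.toClopensᶜ),
        ((A : Set E) ∩ B).Nonempty :=
    ⟨fun h A hA B hB => h A B hA hB, fun h A B hA hB => h A hA B hB⟩
  have meets (A B : Side E) : ¬ A ≤ Bᶜ ↔ ((A : Set E) ∩ B).Nonempty := by
    rw [le_compl_iff_disjoint, not_disjoint_iff_nonempty_inter]
  have meets' (A B : Side E) : ¬ A ≤ B ↔ ((A : Set E) ∩ (Bᶜ : Side E)).Nonempty := by
    rw [← meets, Side.compl_compl]
  rw [h, meets, meets, meets', meets']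
  simp only [Sym2.ball, coe_compl, Clopens.coe_compl]
  tauto

theorem adj_toCut_iff : (cutComplex E).Adj U.toCut V.toCut ↔
    U < V ∨ U < Vᶜ ∨ Uᶜ < V ∨ Uᶜ < Vᶜ := by
  have h : (cutComplex E).Adj U.toCut V.toCut ↔
      U.toCut ≠ V.toCut ∧ (U ≤ V ∨ U ≤ Vᶜ ∨ Uᶜ ≤ V ∨ Uᶜ ≤ Vᶜ) := by
    change _ ∧ ¬ _ ↔ _
    rw [cross_toCut_iff]
    tauto
  rw [h]
  constructor
  · rintro ⟨hne, h⟩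
    have ne {A B : Side E} (hA : A.toCut = U.toCut) (hB : B.toCut = V.toCut) : A ≠ B := by
      rintro rfl
      exact hne (hA.symm.trans hB)
    simpa only [lt_iff_le_and_ne, ne rfl rfl, ne rfl (toCut_compl V), ne (toCut_compl U) rfl,
      ne (toCut_compl U) (toCut_compl V), ne_eq, not_false_eq_true, and_true] using h
  · rintro h
    refine ⟨?_, h.imp le_of_lt (Or.imp le_of_lt (Or.imp le_of_lt le_of_lt))⟩
    rcases h with h | h | h | h <;> simpa only [toCut_compl] using toCut_ne_of_lt h

end Basic

end Side

section Separation

variable {E : Type*} [TopologicalSpace E] [TotallySeparatedSpace E] {A B : Set E}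

theorem exists_isClopen_separating (hA : A.Finite) (hB : B.Finite) (h : Disjoint A B) :
    ∃ G, IsClopen G ∧ A ⊆ G ∧ Disjoint G B := by
  choose! G hG using fun (x y : E) (hxy : x ≠ y) => exists_isClopen_of_totally_separated hxy
  refine ⟨⋃ a ∈ A, ⋂ b ∈ B, G a b, ?_, ?_, ?_⟩
  · exact hA.isClopen_biUnion fun a ha => hB.isClopen_biInter fun b hb =>
      (hG a b (h.ne_of_mem ha hb)).1
  · exact fun a ha => mem_biUnion ha (mem_iInter₂.2 fun b hb => (hG a b (h.ne_of_mem ha hb)).2.1)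
  · simp only [disjoint_left, mem_iUnion₂, mem_iInter₂]
    rintro b ⟨a, ha, hab⟩ hb
    exact (hG a b (h.ne_of_mem ha hb)).2.2 (hab b hb)

namespace Side

theorem exists_separating (hA : A.Finite) (hB : B.Finite) (hA' : A.Nontrivial)
    (hB' : B.Nontrivial) (h : Disjoint A B) :
    ∃ U : Side E, A ⊆ U ∧ Disjoint (U : Set E) B := by
  obtain ⟨G, hG, hAG, hGB⟩ := exists_isClopen_separating hA hB h
  exact ⟨⟨⟨G, hG⟩, hA'.mono hAG, hB'.mono (subset_compl_iff_disjoint_left.2 hGB)⟩, hAG, hGB⟩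

theorem exists_lt_separating {U : Side E} (hA : A.Finite) (hB : B.Finite) (hA' : A.Nontrivial)
    (hB' : B.Nonempty) (h : Disjoint A B) (hAU : A ⊆ U) (hBU : B ⊆ U) :
    ∃ S < U, A ⊆ S ∧ Disjoint (S : Set E) B := by
  obtain ⟨G, hG, hAG, hGB⟩ := exists_isClopen_separating hA hB h
  refine ⟨⟨U.toClopens ⊓ ⟨G, hG⟩, hA'.mono (subset_inter hAU hAG),
    U.nontrivial_compl.mono (compl_subset_compl.2 inter_subset_left)⟩, ?_,
    subset_inter hAU hAG, hGB.mono_left inter_subset_right⟩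
  obtain ⟨b, hb⟩ := hB'
  exact ⟨inter_subset_left, fun hle => disjoint_left.1 hGB (hle (hBU hb)).2 hb⟩

theorem exists_lt_iff {U : Side E} : (∃ V, V < U) ↔ 3 ≤ (U : Set E).encard := by
  constructor
  · rintro ⟨V, hVU⟩
    obtain ⟨x, hxU, hxV⟩ := exists_of_ssubset hVU
    calc (3 : ℕ∞) = 2 + 1 := rfl
      _ ≤ (V : Set E).encard + 1 := by gcongr; exact V.two_le_encard
      _ = (insert x (V : Set E)).encard := (encard_insert_of_notMem hxV).symm
      _ ≤ (U : Set E).encard := encard_le_encard (insert_subset hxU hVU.le)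
  · intro h
    obtain ⟨t, htU, ht⟩ := exists_subset_encard_eq h
    obtain ⟨x, y, z, hxy, hxz, hyz, rfl⟩ := encard_eq_three.1 ht
    simp only [insert_subset_iff, singleton_subset_iff] at htU
    obtain ⟨V, hVU, -⟩ := exists_lt_separating (U := U) (toFinite {x, y}) (toFinite {z})
      (nontrivial_pair hxy) (singleton_nonempty z) (by simp [hxz.symm, hyz.symm])
      (pair_subset htU.1 htU.2.1) (singleton_subset_iff.2 htU.2.2)
    exact ⟨V, hVU⟩

end Side

theorem exists_adj_iff (c : NonperipheralCut E) :
    (∃ d, (cutComplex E).Adj c d) ↔ 5 ≤ ENat.card E := by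
  obtain ⟨U, rfl⟩ := Side.toCut_surjective c
  constructor
  · have five_le {V W : Side E} (h : V < W) : 5 ≤ ENat.card E := by
      rw [← W.encard_add_encard_compl]
      exact add_le_add (Side.exists_lt_iff.1 ⟨V, h⟩) Wᶜ.two_le_encard
    rintro ⟨d, hd⟩
    obtain ⟨V, rfl⟩ := Side.toCut_surjective d
    rcases Side.adj_toCut_iff.1 hd with h | h | h | h <;> exact five_le h
  · intro h5
    have h3 : 3 ≤ (U : Set E).encard ∨ 3 ≤ ((Uᶜ : Side E) : Set E).encard := by
      rw [← U.encard_add_encard_compl] at h5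
      by_contra! ⟨h, h'⟩
      generalize (U : Set E).encard = m, ((Uᶜ : Side E) : Set E).encard = n at *
      enat_to_nat
      omega
    simp only [← Side.exists_lt_iff] at h3
    obtain ⟨V, hV⟩ | ⟨V, hV⟩ := h3
    · exact ⟨V.toCut, (Side.adj_toCut_iff.2 (Or.inl hV)).symm⟩
    · exact ⟨V.toCut, (Side.adj_toCut_iff.2 (Or.inr (Or.inl hV))).symm⟩

theorem exists_nontrivial_disjoint {α : Type*} {s : Set α} (h : 4 ≤ s.encard) :
    ∃ A ⊆ s, ∃ B ⊆ s, A.Finite ∧ B.Finite ∧ A.Nontrivial ∧ B.Nontrivial ∧ Disjoint A B := by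
  obtain ⟨A, hAs, hA⟩ := exists_subset_encard_eq (le_trans (by norm_num : (2 : ℕ∞) ≤ 4) h)
  have hsA : 2 ≤ (s \ A).encard := by
    rw [← encard_sdiff_add_encard_of_subset hAs, hA] at h
    generalize (s \ A).encard = n at *
    enat_to_nat
    omega
  obtain ⟨B, hBs, hB⟩ := exists_subset_encard_eq hsA
  have nontrivial {t : Set α} (ht : t.encard = 2) : t.Nontrivial :=
    one_lt_encard_iff_nontrivial.1 (ht ▸ by norm_num)
  exact ⟨A, hAs, B, hBs.trans sdiff_subset, finite_of_encard_eq_coe hA,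
    finite_of_encard_eq_coe hB, nontrivial hA, nontrivial hB,
    (disjoint_sdiff_left.mono_left hBs).symm⟩

theorem nonempty_nonperipheralCut_iff : Nonempty (NonperipheralCut E) ↔ 4 ≤ ENat.card E := by
  constructor
  · rintro ⟨c⟩
    obtain ⟨U, -⟩ := Side.toCut_surjective c
    rw [← U.encard_add_encard_compl]
    exact add_le_add U.two_le_encard Uᶜ.two_le_encard
  · rw [← encard_univ]
    intro h4
    obtain ⟨A, -, B, -, hA, hB, hA', hB', hAB⟩ := exists_nontrivial_disjoint h4
    obtain ⟨U, -⟩ := Side.exists_separating hA hB hA' hB' hAB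
    exact ⟨U.toCut⟩

end Separation

/-- The relation by which the complex of cuts remembers sides: for neighbours `c` and `d` of a
vertex `u`, some neighbour of `u` is adjacent to neither of them. For cuts, this says that `c` and
`d` lie on the same side of `u`. -/
def SameSide {V : Type*} (G : SimpleGraph V) (u c d : V) : Prop :=
  ∃ e, G.Adj u e ∧ ¬ G.Adj c e ∧ ¬ G.Adj d e

theorem SameSide.symm {V : Type*} {G : SimpleGraph V} {u c d : V} (h : SameSide G u c d) :
    SameSide G u d c :=
  let ⟨e, hu, hc, hd⟩ := h
  ⟨e, hu, hd, hc⟩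

theorem sameSide_map_iff {V V' : Type*} {G : SimpleGraph V} {G' : SimpleGraph V'} (Φ : G ≃g G')
    {u c d : V} : SameSide G' (Φ u) (Φ c) (Φ d) ↔ SameSide G u c d := by
  simp only [SameSide, Φ.surjective.exists, Φ.map_adj_iff]

namespace Side

section Inside

variable {E : Type*} [TopologicalSpace E] {U V W S : Side E} {c d : NonperipheralCut E}

/-- The cuts nested in `U`, that is, having a side properly contained in `U`. -/
def inside (U : Side E) : Set (NonperipheralCut E) := toCut '' Iio U

theorem toCut_mem_inside : V.toCut ∈ U.inside ↔ V < U ∨ Vᶜ < U := by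
  constructor
  · rintro ⟨W, hW, hWV⟩
    rcases toCut_eq_toCut_iff.1 hWV with rfl | rfl
    exacts [Or.inl hW, Or.inr hW]
  · rintro (h | h)
    exacts [⟨V, h, rfl⟩, ⟨Vᶜ, h, toCut_compl V⟩]

theorem disjoint_inside_compl (U : Side E) : Disjoint U.inside Uᶜ.inside := by
  rw [disjoint_left]
  rintro _ ⟨V, hV, rfl⟩ h
  rcases toCut_mem_inside.1 h with h | h
  · exact not_lt_compl_of_lt hV h
  · exact (Side.compl_lt_compl_iff.1 h).asymm hV

theorem adj_toCut_iff_mem_inside :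
    (cutComplex E).Adj U.toCut c ↔ c ∈ U.inside ∨ c ∈ Uᶜ.inside := by
  obtain ⟨V, rfl⟩ := toCut_surjective c
  rw [adj_toCut_iff, toCut_mem_inside, toCut_mem_inside, Side.compl_lt_compl_iff,
    Side.compl_lt_compl_iff, Side.lt_compl_comm, Side.compl_lt_comm]
  tauto

theorem mem_inside_compl_iff :
    c ∈ Uᶜ.inside ↔ (cutComplex E).Adj U.toCut c ∧ c ∉ U.inside := by
  have : c ∈ U.inside → c ∉ Uᶜ.inside := fun h => disjoint_left.1 U.disjoint_inside_compl h
  rw [adj_toCut_iff_mem_inside]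
  tauto

theorem adj_of_mem_inside_of_mem_inside_compl (hc : c ∈ U.inside) (hd : d ∈ Uᶜ.inside) :
    (cutComplex E).Adj c d := by
  obtain ⟨V, hV, rfl⟩ := hc
  obtain ⟨W, hW, rfl⟩ := hd
  exact adj_toCut_iff.2 (Or.inr (Or.inl (hV.trans (Side.lt_compl_comm.1 hW))))

theorem lt_iff_toCut_mem_inside : U < V ↔ U.toCut ∈ V.inside ∧ V.toCut ∈ Uᶜ.inside := by
  rw [toCut_mem_inside, toCut_mem_inside, Side.compl_lt_compl_iff]
  constructor
  · exact fun h => ⟨Or.inl h, Or.inr h⟩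
  · rintro ⟨h | h, h' | h'⟩
    exacts [h, h, (h.asymm h').elim, h']

theorem not_adj_toCut_of_lt_of_lt (hV : V < U) (hS : S < U) (hVS : ¬ Disjoint (V : Set E) S)
    (hVS' : ¬ V ≤ S) (hSV : ¬ S ≤ V) : ¬ (cutComplex E).Adj V.toCut S.toCut := by
  rw [adj_toCut_iff]
  rintro (h | h | h | h)
  · exact hVS' h.le
  · exact hVS (le_compl_iff_disjoint.1 h.le)
  · exact not_compl_lt_of_lt hV (h.trans hS)
  · exact hSV (Side.compl_lt_compl_iff.1 h).le

section Separated

variable [TotallySeparatedSpace E]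

theorem sameSide_toCut_of_lt (hVW : V < W) (hWU : W < U) :
    SameSide (cutComplex E) U.toCut V.toCut W.toCut := by
  obtain ⟨a, ha, b, hb, hab⟩ := V.nontrivial
  obtain ⟨u, huU, huW⟩ := exists_of_ssubset hWU
  have huV : u ∉ V := fun h => huW (hVW.le h)
  have hVU := hVW.trans hWU
  obtain ⟨S, hSU, haS, hbS⟩ := exists_lt_separating (U := U) (toFinite {a, u}) (toFinite {b})
    (nontrivial_pair (ne_of_mem_of_not_mem ha huV)) (singleton_nonempty b)
    (by simp [hab.symm, ne_of_mem_of_not_mem hb huV]) (pair_subset (hVU.le ha) huU)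
    (singleton_subset_iff.2 (hVU.le hb))
  rw [insert_subset_iff, singleton_subset_iff] at haS
  rw [disjoint_singleton_right] at hbS
  exact ⟨S.toCut, adj_toCut_iff_mem_inside.2 (Or.inl ⟨S, hSU, rfl⟩),
    not_adj_toCut_of_lt_of_lt hVU hSU (not_disjoint_iff.2 ⟨a, ha, haS.1⟩) (fun h => hbS (h hb))
      fun h => huV (h haS.2),
    not_adj_toCut_of_lt_of_lt hWU hSU (not_disjoint_iff.2 ⟨a, hVW.le ha, haS.1⟩)
      (fun h => hbS (h (hVW.le hb))) fun h => huW (h haS.2)⟩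

theorem sameSide_toCut_of_disjoint (hVU : V < U) (hWU : W < U) (h : Disjoint (V : Set E) W) :
    SameSide (cutComplex E) U.toCut V.toCut W.toCut := by
  obtain ⟨a, ha, b, hb, hab⟩ := V.nontrivial
  obtain ⟨a', ha', b', hb', hab'⟩ := W.nontrivial
  obtain ⟨S, hSU, haS, hbS⟩ := exists_lt_separating (U := U) (toFinite {a, a'}) (toFinite {b, b'})
    (nontrivial_pair (h.ne_of_mem ha ha')) (insert_nonempty b _)
    (by simp [hab.symm, hab'.symm, (h.ne_of_mem ha hb').symm, h.ne_of_mem hb ha'])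
    (pair_subset (hVU.le ha) (hWU.le ha')) (pair_subset (hVU.le hb) (hWU.le hb'))
  simp only [insert_subset_iff, singleton_subset_iff] at haS
  simp only [disjoint_insert_right, disjoint_singleton_right] at hbS
  exact ⟨S.toCut, adj_toCut_iff_mem_inside.2 (Or.inl ⟨S, hSU, rfl⟩),
    not_adj_toCut_of_lt_of_lt hVU hSU (not_disjoint_iff.2 ⟨a, ha, haS.1⟩)
      (fun hle => hbS.1 (hle hb)) fun hle => disjoint_left.1 h (hle haS.2) ha',
    not_adj_toCut_of_lt_of_lt hWU hSU (not_disjoint_iff.2 ⟨a', ha', haS.2⟩)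
      (fun hle => hbS.2 (hle hb')) fun hle => disjoint_left.1 h ha (hle haS.1)⟩

theorem sameSide_of_mem_inside (hc : c ∈ U.inside) (hd : d ∈ U.inside) :
    SameSide (cutComplex E) U.toCut c d := by
  by_cases hcd : (cutComplex E).Adj c d
  · obtain ⟨V, hV, rfl⟩ := hc
    obtain ⟨W, hW, rfl⟩ := hd
    rcases adj_toCut_iff.1 hcd with h | h | h | h
    · exact sameSide_toCut_of_lt h hW
    · exact sameSide_toCut_of_disjoint hV hW (le_compl_iff_disjoint.1 h.le)
    · exact (not_compl_lt_of_lt hV (h.trans hW)).elim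
    · exact (sameSide_toCut_of_lt (Side.compl_lt_compl_iff.1 h) hV).symm
  · exact ⟨c, adj_toCut_iff_mem_inside.2 (Or.inl hc), (cutComplex E).irrefl,
      fun h => hcd h.symm⟩

theorem mem_inside_iff_sameSide (hc : c ∈ U.inside) :
    d ∈ U.inside ↔ (cutComplex E).Adj U.toCut d ∧ SameSide (cutComplex E) U.toCut c d := by
  refine ⟨fun hd => ⟨adj_toCut_iff_mem_inside.2 (Or.inl hd), sameSide_of_mem_inside hc hd⟩, ?_⟩
  rintro ⟨hd, e, hue, hce, hde⟩
  refine (adj_toCut_iff_mem_inside.1 hd).resolve_right fun hd => ?_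
  rcases adj_toCut_iff_mem_inside.1 hue with he | he
  · exact hde (adj_of_mem_inside_of_mem_inside_compl he hd).symm
  · exact hce (adj_of_mem_inside_of_mem_inside_compl hc he)

end Separated

end Inside

end Side

/-- `U'` is a lift to sides, at `U`, of the isomorphism `Φ` of complexes of cuts: the cut of `U`
is mapped to the cut of `U'`, and the cuts nested in `U` to those nested in `U'`. -/
structure IsLift {E E' : Type*} [TopologicalSpace E] [TopologicalSpace E']
    (Φ : cutComplex E ≃g cutComplex E') (U : Side E) (U' : Side E') : Prop where
  toCut_eq : U'.toCut = Φ U.toCut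
  map_mem_inside_iff : ∀ c, Φ c ∈ U'.inside ↔ c ∈ U.inside

namespace IsLift

open Side

variable {E E' : Type*} [TopologicalSpace E] [TopologicalSpace E']
  {Φ : cutComplex E ≃g cutComplex E'} {U V : Side E} {U' V' U'' : Side E'}

theorem compl (h : IsLift Φ U U') : IsLift Φ Uᶜ U'ᶜ where
  toCut_eq := by rw [toCut_compl, toCut_compl, h.toCut_eq]
  map_mem_inside_iff c := by
    rw [mem_inside_compl_iff, mem_inside_compl_iff, h.toCut_eq, Φ.map_adj_iff,
      h.map_mem_inside_iff]

theorem symm (h : IsLift Φ U U') : IsLift Φ.symm U' U where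
  toCut_eq := by rw [h.toCut_eq, Φ.symm_apply_apply]
  map_mem_inside_iff c := by rw [← h.map_mem_inside_iff, Φ.apply_symm_apply]

theorem lt_iff_lt (hU : IsLift Φ U U') (hV : IsLift Φ V V') : U' < V' ↔ U < V := by
  rw [lt_iff_toCut_mem_inside, lt_iff_toCut_mem_inside, hU.toCut_eq, hV.toCut_eq,
    hV.map_mem_inside_iff, hU.compl.map_mem_inside_iff]

theorem unique {d : NonperipheralCut E} (hd : (cutComplex E).Adj U.toCut d) (h : IsLift Φ U U')
    (h' : IsLift Φ U U'') : U' = U'' := by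
  refine (toCut_eq_toCut_iff.1 (h.toCut_eq.trans h'.toCut_eq.symm)).resolve_right ?_
  rintro rfl
  rcases adj_toCut_iff_mem_inside.1 hd with hd | hd
  · exact disjoint_left.1 U''.disjoint_inside_compl ((h'.map_mem_inside_iff d).2 hd)
      ((h.map_mem_inside_iff d).2 hd)
  · have hd' := (h.compl.map_mem_inside_iff d).2 hd
    rw [Side.compl_compl] at hd'
    exact disjoint_left.1 U''.disjoint_inside_compl hd' ((h'.compl.map_mem_inside_iff d).2 hd)

variable [TotallySeparatedSpace E] [TotallySeparatedSpace E']

theorem of_mem_inside {c : NonperipheralCut E} (hc : c ∈ U.inside) (hU : U'.toCut = Φ U.toCut)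
    (hc' : Φ c ∈ U'.inside) : IsLift Φ U U' where
  toCut_eq := hU
  map_mem_inside_iff d := by
    rw [mem_inside_iff_sameSide hc', mem_inside_iff_sameSide hc, hU, Φ.map_adj_iff,
      sameSide_map_iff]

theorem exists_of_adj {d : NonperipheralCut E} (hd : (cutComplex E).Adj U.toCut d) :
    ∃ U' : Side E', IsLift Φ U U' := by
  wlog hdU : d ∈ U.inside generalizing U
  · have hd' : d ∈ Uᶜ.inside := (adj_toCut_iff_mem_inside.1 hd).resolve_left hdU
    obtain ⟨U', hU'⟩ := this (U := Uᶜ) (by rwa [toCut_compl]) hd'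
    exact ⟨U'ᶜ, Side.compl_compl U ▸ hU'.compl⟩
  obtain ⟨U', hU'⟩ := toCut_surjective (Φ U.toCut)
  rw [← Φ.map_adj_iff, ← hU'] at hd
  rcases adj_toCut_iff_mem_inside.1 hd with hd | hd
  · exact ⟨U', of_mem_inside hdU hU' hd⟩
  · exact ⟨U'ᶜ, of_mem_inside hdU ((toCut_compl U').trans hU') hd⟩

end IsLift

theorem exists_orderIso_of_cutComplex_iso {E E' : Type*} [TopologicalSpace E]
    [TotallySeparatedSpace E] [TopologicalSpace E'] [TotallySeparatedSpace E']
    (Φ : cutComplex E ≃g cutComplex E') (hE : 5 ≤ ENat.card E) (hE' : 5 ≤ ENat.card E') :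
    ∃ φ : Side E ≃o Side E', (∀ U, φ Uᶜ = (φ U)ᶜ) ∧ ∀ U, (φ U).toCut = Φ U.toCut := by
  choose nbr hnbr using fun c : NonperipheralCut E => (exists_adj_iff c).2 hE
  choose nbr' hnbr' using fun c : NonperipheralCut E' => (exists_adj_iff c).2 hE'
  choose φ hφ using fun U : Side E => IsLift.exists_of_adj (Φ := Φ) (hnbr U.toCut)
  choose ψ hψ using fun U : Side E' => IsLift.exists_of_adj (Φ := Φ.symm) (hnbr' U.toCut)
  have hψφ (U : Side E) : ψ (φ U) = U := IsLift.unique (hnbr' _) (hψ (φ U)) (hφ U).symm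
  have hφψ (U : Side E') : φ (ψ U) = U := IsLift.unique (hnbr _) (hφ (ψ U)) (hψ U).symm
  let e : Side E ≃ Side E' := ⟨φ, ψ, hψφ, hφψ⟩
  have map_le_iff {U V : Side E} : e U ≤ e V ↔ U ≤ V := by
    rw [le_iff_lt_or_eq, le_iff_lt_or_eq, e.apply_eq_iff_eq]
    exact or_congr_left ((hφ U).lt_iff_lt (hφ V))
  exact ⟨⟨e, map_le_iff⟩, fun U => IsLift.unique (hnbr _) (hφ Uᶜ) (hφ U).compl,
    fun U => (hφ U).toCut_eq⟩

theorem nontrivial_compl_triple {α : Type*} (h : 5 ≤ ENat.card α) (p q r : α) :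
    ({p, q, r} : Set α)ᶜ.Nontrivial := by
  have h3 : ({p, q, r} : Set α).encard ≤ 1 + 1 + 1 := by
    grw [encard_insert_le, encard_insert_le, encard_singleton]
  rw [← encard_univ, ← Set.encard_add_encard_compl ({p, q, r} : Set α)] at h
  rw [← one_lt_encard_iff_nontrivial]
  generalize ({p, q, r} : Set α).encard = m, ({p, q, r} : Set α)ᶜ.encard = n at *
  enat_to_nat
  omega

namespace Side

section OrderIso

variable {E E' : Type*} [TopologicalSpace E] [TopologicalSpace E'] {φ : Side E ≃o Side E'}
  {U V W : Side E} {y : E'}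

theorem coe_map_inter (φ : Side E ≃o Side E') (h : ((U : Set E) ∩ V).Nontrivial) :
    (φ (U.inter V h) : Set E') = (φ U : Set E') ∩ φ V := by
  have hle : (φ (U.inter V h) : Set E') ⊆ (φ U : Set E') ∩ φ V :=
    subset_inter (φ.monotone inter_subset_left) (φ.monotone inter_subset_right)
  have hN : ((φ U : Set E') ∩ φ V).Nontrivial := (φ _).nontrivial.mono hle
  have hN' : φ.symm ((φ U).inter (φ V) hN) ≤ U.inter V h :=
    subset_inter (φ.symm_apply_le.2 inter_subset_left) (φ.symm_apply_le.2 inter_subset_right)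
  exact hle.antisymm (φ.symm_apply_le.1 hN')

theorem disjoint_map_iff (hφ : ∀ U, φ Uᶜ = (φ U)ᶜ) :
    Disjoint (φ U : Set E') (φ V) ↔ Disjoint (U : Set E) V := by
  rw [← le_compl_iff_disjoint, ← le_compl_iff_disjoint, ← hφ, φ.le_iff_le]

theorem notMem_map_of_nontrivial_inter (hφ : ∀ U, φ Uᶜ = (φ U)ᶜ)
    (hUV : ((U : Set E) ∩ V).Nontrivial) (h : ∀ x ∈ U, x ∈ V → x ∉ W)
    (hyU : y ∈ φ U) (hyV : y ∈ φ V) : y ∉ φ W := by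
  have hd : Disjoint (φ (U.inter V hUV) : Set E') (φ W) :=
    (disjoint_map_iff hφ).2 (disjoint_left.2 fun x hx => h x hx.1 hx.2)
  rw [coe_map_inter] at hd
  exact disjoint_left.1 hd ⟨hyU, hyV⟩

theorem notMem_map_of_nontrivial_diff (hφ : ∀ U, φ Uᶜ = (φ U)ᶜ)
    (hUV : ((U : Set E) \ V).Nontrivial) (hUW : ((U : Set E) \ W).Nontrivial)
    (h : ∀ x ∈ U, x ∈ V → x ∉ W) (hyU : y ∈ φ U) (hyV : y ∈ φ V) : y ∉ φ W := by
  intro hyW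
  have mem_map_compl {A B : Side E} (hAB : Disjoint (A : Set E) B) (hB : y ∈ φ B) : y ∈ φ Aᶜ := by
    rw [hφ]
    exact fun hA => disjoint_left.1 ((disjoint_map_iff hφ).2 hAB) hA hB
  -- Since `U` is the union of `A` and `B`, its complement is the intersection of `Aᶜ` and `Bᶜ`.
  let A : Side E := U.inter Vᶜ hUV
  let B : Side E := U.inter Wᶜ hUW
  have hAV : Disjoint (A : Set E) V := disjoint_left.2 fun _ hx => hx.2
  have hBW : Disjoint (B : Set E) W := disjoint_left.2 fun _ hx => hx.2
  have hAB : ((Aᶜ : Side E) ∩ (Bᶜ : Side E) : Set E).Nontrivial :=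
    U.nontrivial_compl.mono fun x hx => ⟨fun hA => hx hA.1, fun hB => hx hB.1⟩
  refine notMem_map_of_nontrivial_inter hφ hAB (fun x hA hB hx => ?_)
    (mem_map_compl hAV hyV) (mem_map_compl hBW hyW) hyU
  by_cases hxV : x ∈ V
  · exact hB ⟨hx, h x hx hxV⟩
  · exact hA ⟨hx, hxV⟩

theorem mem_or_mem_of_mem_map (hφ : ∀ U, φ Uᶜ = (φ U)ᶜ)
    (hUV : ((U : Set E) ∩ V).Nonempty) (hUW : ((U : Set E) ∩ W).Nonempty)
    (h : ∀ x ∈ U, x ∈ V → x ∉ W) (hyU : y ∈ φ U) (hyV : y ∈ φ V) (hyW : y ∈ φ W)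
    {x : E} (hx : x ∈ U) : x ∈ V ∨ x ∈ W := by
  obtain ⟨v, hvU, hvV⟩ := hUV
  obtain ⟨w, hwU, hwW⟩ := hUW
  by_contra! hx'
  have hwV : w ∉ V := fun hwV => h w hwU hwV hwW
  refine notMem_map_of_nontrivial_diff hφ ⟨x, ⟨hx, hx'.1⟩, w, ⟨hwU, hwV⟩, ?_⟩
    ⟨x, ⟨hx, hx'.2⟩, v, ⟨hvU, h v hvU hvV⟩, ?_⟩ h hyU hyV hyW
  · exact (ne_of_mem_of_not_mem hwW hx'.2).symm
  · exact (ne_of_mem_of_not_mem hvV hx'.1).symm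

theorem eq_or_eq_of_mem_map (hφ : ∀ U, φ Uᶜ = (φ U)ᶜ) (h : ∀ x ∈ U, x ∈ V → x ∉ W)
    (hyU : y ∈ φ U) (hyV : y ∈ φ V) (hyW : y ∈ φ W) {a b x : E} (ha : a ∈ (U ∩ V : Set E))
    (hb : b ∈ (U ∩ W : Set E)) (hx : x ∈ U) : x = a ∨ x = b := by
  have hUV : ((U : Set E) ∩ V).Subsingleton := not_nontrivial_iff.1 fun hn =>
    notMem_map_of_nontrivial_inter hφ hn h hyU hyV hyW
  have hUW : ((U : Set E) ∩ W).Subsingleton := not_nontrivial_iff.1 fun hn =>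
    notMem_map_of_nontrivial_inter hφ hn (fun x hU hW hV => h x hU hV hW) hyU hyW hyV
  exact (mem_or_mem_of_mem_map hφ ⟨a, ha⟩ ⟨b, hb⟩ h hyU hyV hyW hx).imp
    (fun hV => hUV ⟨hx, hV⟩ ha) fun hW => hUW ⟨hx, hW⟩ hb

theorem notMem_map_of_forall_notMem [TotallySeparatedSpace E] (hφ : ∀ U, φ Uᶜ = (φ U)ᶜ)
    (hE : 5 ≤ ENat.card E) (h : ∀ x ∈ U, x ∈ V → x ∉ W)
    (hyU : y ∈ φ U) (hyV : y ∈ φ V) : y ∉ φ W := by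
  intro hyW
  have meet {A B : Side E} (hA : y ∈ φ A) (hB : y ∈ φ B) : ((A : Set E) ∩ B).Nonempty := by
    rw [← not_disjoint_iff_nonempty_inter, ← disjoint_map_iff hφ, not_disjoint_iff]
    exact ⟨y, hA, hB⟩
  obtain ⟨p, hpU, hpV⟩ := meet hyU hyV
  obtain ⟨q, hqV, hqW⟩ := meet hyV hyW
  obtain ⟨r, hrU, hrW⟩ := meet hyU hyW
  have notMem {z : E} (hz : z ∉ ({p, q, r} : Set E)) : z ∉ U ∧ z ∉ V ∧ z ∉ W := by
    simp only [mem_insert_iff, mem_singleton_iff, not_or] at hz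
    refine ⟨fun hU => ?_, fun hV => ?_, fun hW => ?_⟩
    · exact (eq_or_eq_of_mem_map hφ h hyU hyV hyW ⟨hpU, hpV⟩ ⟨hrU, hrW⟩ hU).elim hz.1 hz.2.2
    · exact (eq_or_eq_of_mem_map hφ (fun x hV hW hU => h x hU hV hW) hyV hyW hyU
        ⟨hqV, hqW⟩ ⟨hpV, hpU⟩ hV).elim hz.2.1 hz.1
    · exact (eq_or_eq_of_mem_map hφ (fun x hW hU hV => h x hU hV hW) hyW hyU hyV
        ⟨hrW, hrU⟩ ⟨hqW, hqV⟩ hW).elim hz.2.2 hz.2.1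
  obtain ⟨e, he, e', he', hee'⟩ := nontrivial_compl_triple hE p q r
  -- Adding to `U` points outside `V` and `W` keeps the triple intersection empty.
  obtain ⟨G, hG, heG, he'G⟩ := exists_isClopen_of_totally_separated hee'
  let Z : Clopens E := ⟨G, hG⟩ ⊓ V.toClopensᶜ ⊓ W.toClopensᶜ
  let U' : Side E := ⟨U.toClopens ⊔ Z, U.nontrivial.mono subset_union_left,
    ⟨q, fun hq => hq.elim (fun hU => h q hU hqV hqW) fun hZ => hZ.2 hqW,
      e', fun he => he.elim (notMem he').1 fun hZ => he'G hZ.1.1,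
      ne_of_mem_of_not_mem (mem_insert_of_mem p (mem_insert q _)) he'⟩⟩
  have hUU' : U ≤ U' := subset_union_left
  have h' : ∀ x ∈ U', x ∈ V → x ∉ W := by
    rintro x (hx | hx)
    exacts [h x hx, fun hV => (hx.1.2 hV).elim]
  exact (mem_or_mem_of_mem_map hφ ⟨p, hUU' hpU, hpV⟩ ⟨r, hUU' hrU, hrW⟩ h'
    (φ.monotone hUU' hyU) hyV hyW (Or.inr ⟨⟨heG, (notMem he).2.1⟩, (notMem he).2.2⟩)).elim
      (notMem he).2.1 (notMem he).2.2

theorem coe_map_inter_coe_map_subset [TotallySeparatedSpace E] (hφ : ∀ U, φ Uᶜ = (φ U)ᶜ)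
    (hE : 5 ≤ ENat.card E) (h : (V ∩ W : Set E) ⊆ U) : (φ V ∩ φ W : Set E') ⊆ φ U := by
  rintro y ⟨hyV, hyW⟩
  have hy : y ∉ φ Uᶜ :=
    notMem_map_of_forall_notMem hφ hE (fun x hV hW hx => hx (h ⟨hV, hW⟩)) hyV hyW
  rwa [hφ, mem_compl, not_not] at hy

end OrderIso

end Side

section Stone

variable {E : Type*} [TopologicalSpace E] [CompactSpace E] [T2Space E] [TotallyDisconnectedSpace E]

theorem exists_mem_inter_subset (hE : 5 ≤ ENat.card E) {O : Set E} (hO : IsOpen O) {x : E}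
    (hx : x ∈ O) : ∃ U V : Side E, x ∈ U ∧ x ∈ V ∧ (U ∩ V : Set E) ⊆ O := by
  have h4 : 4 ≤ ({x}ᶜ : Set E).encard := by
    rw [← encard_univ, ← Set.encard_add_encard_compl {x}, encard_singleton] at hE
    generalize ({x}ᶜ : Set E).encard = n at *
    enat_to_nat
    omega
  obtain ⟨A, hxA, B, hxB, hA, hB, hA', hB', hAB⟩ := exists_nontrivial_disjoint h4
  obtain ⟨H, hH, hAH, hHB⟩ := exists_isClopen_separating hA hB hAB
  obtain ⟨G, hG, hxG, hGO⟩ := compact_exists_isClopen_in_isOpen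
    (hO.inter (hA.union hB).isClosed.isOpen_compl)
    ⟨hx, fun h => h.elim (fun h => hxA h rfl) fun h => hxB h rfl⟩
  let U : Side E := ⟨⟨G, hG⟩ ⊔ ⟨H, hH⟩, hA'.mono (hAH.trans subset_union_right),
    hB'.mono fun b hb h => h.elim (fun hbG => (hGO hbG).2 (Or.inr hb)) fun hbH =>
      disjoint_left.1 hHB hbH hb⟩
  let V : Side E := ⟨⟨G, hG⟩ ⊔ ⟨H, hH⟩ᶜ,
    hB'.mono ((subset_compl_iff_disjoint_left.2 hHB).trans subset_union_right),
    hA'.mono fun a ha h => h.elim (fun haG => (hGO haG).2 (Or.inl ha)) fun haH => haH (hAH ha)⟩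
  refine ⟨U, V, Or.inl hxG, Or.inl hxG, ?_⟩
  rintro z ⟨hz | hz, hz' | hz'⟩
  exacts [(hGO hz).1, (hGO hz).1, (hGO hz').1, (hz' hz).elim]

theorem eq_of_forall_mem_side (hE : 5 ≤ ENat.card E) {x y : E}
    (h : ∀ U : Side E, x ∈ U → y ∈ U) : x = y := by
  by_contra hxy
  obtain ⟨U, V, hxU, hxV, hUV⟩ := exists_mem_inter_subset hE isOpen_compl_singleton hxy
  exact hUV ⟨h U hxU, h V hxV⟩ rfl

variable {E' : Type*} [TopologicalSpace E'] {φ : Side E ≃o Side E'}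

theorem exists_forall_mem_map_iff [CompactSpace E'] (hφ : ∀ U, φ Uᶜ = (φ U)ᶜ)
    (hE : 5 ≤ ENat.card E) (x : E) : ∃ y, ∀ U, y ∈ φ U ↔ x ∈ U := by
  let ι := {p : Side E × Side E // x ∈ p.1 ∧ x ∈ p.2}
  let Z (i : ι) : Set E' := φ i.1.1 ∩ φ i.1.2
  have hZ (i : ι) : IsClosed (Z i) :=
    (φ i.1.1).isClopen.isClosed.inter (φ i.1.2).isClopen.isClosed
  have nonempty (i : ι) : (Z i).Nonempty := by
    rw [← not_disjoint_iff_nonempty_inter, Side.disjoint_map_iff hφ, not_disjoint_iff]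
    exact ⟨x, i.2⟩
  have directed : Directed (· ⊇ ·) Z := by
    intro i j
    have hO : IsOpen ((i.1.1 ∩ i.1.2) ∩ (j.1.1 ∩ j.1.2) : Set E) :=
      (i.1.1.isClopen.inter i.1.2.isClopen).inter (j.1.1.isClopen.inter j.1.2.isClopen) |>.isOpen
    obtain ⟨U, V, hU, hV, hUV⟩ := exists_mem_inter_subset hE hO ⟨i.2, j.2⟩
    have sub {W : Side E} (hW : (U ∩ V : Set E) ⊆ W) : (φ U ∩ φ V : Set E') ⊆ φ W :=
      Side.coe_map_inter_coe_map_subset hφ hE hW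
    exact ⟨⟨(U, V), hU, hV⟩,
      subset_inter (sub fun z hz => (hUV hz).1.1) (sub fun z hz => (hUV hz).1.2),
      subset_inter (sub fun z hz => (hUV hz).2.1) (sub fun z hz => (hUV hz).2.2)⟩
  have : Nonempty ι := by
    obtain ⟨U, V, hU, hV, -⟩ := exists_mem_inter_subset hE isOpen_univ (mem_univ x)
    exact ⟨⟨(U, V), hU, hV⟩⟩
  obtain ⟨y, hy⟩ := IsCompact.nonempty_iInter_of_directed_nonempty_isCompact_isClosed Z directed
    nonempty (fun i => (hZ i).isCompact) hZ
  have mem_map {U : Side E} (hU : x ∈ U) : y ∈ φ U := (mem_iInter.1 hy ⟨(U, U), hU, hU⟩).1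
  refine ⟨y, fun U => ⟨fun hyU => ?_, mem_map⟩⟩
  by_contra hxU
  have hyU' : y ∈ φ Uᶜ := mem_map hxU
  rw [hφ] at hyU'
  exact hyU' hyU

theorem exists_homeomorph_of_orderIso [CompactSpace E'] [T2Space E'] [TotallyDisconnectedSpace E']
    (hφ : ∀ U, φ Uᶜ = (φ U)ᶜ) (hE : 5 ≤ ENat.card E) (hE' : 5 ≤ ENat.card E') :
    ∃ f : E ≃ₜ E', ∀ U x, f x ∈ φ U ↔ x ∈ U := by
  have hφ' (V : Side E') : φ.symm Vᶜ = (φ.symm V)ᶜ := by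
    rw [OrderIso.symm_apply_eq, hφ, φ.apply_symm_apply]
  choose f hf using exists_forall_mem_map_iff hφ hE
  choose g hg using exists_forall_mem_map_iff hφ' hE'
  have mem_iff (x : E) (V : Side E') : f x ∈ V ↔ x ∈ φ.symm V := by
    rw [← hf, φ.apply_symm_apply]
  let e : E ≃ E' :=
    { toFun := f
      invFun := g
      left_inv x := (eq_of_forall_mem_side hE fun U hx => by
        rwa [← φ.symm_apply_apply U, hg, hf]).symm
      right_inv y := (eq_of_forall_mem_side hE' fun V hy => by rwa [mem_iff, hg]).symm }
  have he : Continuous e := by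
    refine continuous_def.2 fun O hO => isOpen_iff_mem_nhds.2 fun x hx => ?_
    obtain ⟨U, V, hU, hV, hUV⟩ := exists_mem_inter_subset hE' hO hx
    filter_upwards [(φ.symm U).isClopen.isOpen.mem_nhds ((mem_iff x U).1 hU),
      (φ.symm V).isClopen.isOpen.mem_nhds ((mem_iff x V).1 hV)] with z hzU hzV
    exact hUV ⟨(mem_iff z U).2 hzU, (mem_iff z V).2 hzV⟩
  exact ⟨he.homeoOfEquivCompactToT2, fun U x => hf x U⟩

end Stone

theorem toCut_eq_map {E E' : Type*} [TopologicalSpace E] [TopologicalSpace E'] (f : E ≃ₜ E')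
    {U : Side E} {U' : Side E'} (h : ∀ x, f x ∈ U' ↔ x ∈ U) :
    U'.toCut.1 = U.toCut.1.map f := by
  have hU : clopenImage f U.toClopens = U'.toClopens :=
    Clopens.ext ((f.image_eq_preimage_symm _).trans <| Set.ext fun y => by
      rw [mem_preimage, ← f.apply_symm_apply y, f.symm_apply_apply]
      exact (h (f.symm y)).symm)
  apply Subtype.ext
  change s(U'.toClopens, U'.toClopensᶜ) = s(clopenImage f U.toClopens, clopenImage f U.toClopensᶜ)
  rw [clopenImage_compl, hU]

section FourPoints

variable {E : Type*} [TopologicalSpace E] [DiscreteTopology E] {x y : E}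

namespace Side

/-- The side `{x, y}` in a discrete space with four points. -/
def pair (hE : ENat.card E = 4) (h : y ≠ x) : Side E where
  toClopens := ⟨{x, y}, isClopen_discrete _⟩
  nontrivial' := nontrivial_pair h.symm
  nontrivial_compl' := by
    have hcard := Set.encard_add_encard_compl ({x, y} : Set E)
    rw [encard_univ, hE, encard_pair h.symm] at hcard
    rw [← one_lt_encard_iff_nontrivial]
    generalize ({x, y} : Set E)ᶜ.encard = n at *
    enat_to_nat
    omega

theorem mem_pair {hE : ENat.card E = 4} {h : y ≠ x} {z : E} :
    z ∈ pair hE h ↔ z = x ∨ z = y := Iff.rfl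

theorem exists_eq_pair (hE : ENat.card E = 4) {U : Side E} (hx : x ∈ U) :
    ∃ (y : E) (h : y ≠ x), U = pair hE h := by
  have hU : (U : Set E).encard ≤ 2 := by
    have hcard : (U : Set E).encard + 2 ≤ 4 :=
      (add_le_add le_rfl Uᶜ.two_le_encard).trans_eq (U.encard_add_encard_compl.trans hE)
    generalize (U : Set E).encard = m at *
    enat_to_nat
    omega
  obtain ⟨y, hy, hyx⟩ := U.nontrivial.exists_ne x
  have hxy : {x, y} = (U : Set E) := (toFinite _).eq_of_subset_of_encard_le (pair_subset hx hy)
    (hU.trans_eq (encard_pair hyx.symm).symm)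
  exact ⟨y, hyx, SetLike.coe_injective hxy.symm⟩

theorem bijective_toCut_pair (hE : ENat.card E = 4) (x : E) :
    Function.Bijective fun y : {y // y ≠ x} => (pair hE y.2).toCut := by
  constructor
  · intro y z h
    rcases toCut_eq_toCut_iff.1 h with h | h
    · have hy : y.1 ∈ pair hE z.2 := h ▸ mem_pair.2 (Or.inr rfl)
      exact Subtype.ext ((mem_pair.1 hy).resolve_left y.2)
    · have hx : x ∈ (pair hE z.2)ᶜ := h ▸ mem_pair.2 (Or.inl rfl)
      exact (hx (mem_pair.2 (Or.inl rfl))).elim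
  · intro c
    obtain ⟨U, rfl, hU⟩ := exists_toCut_eq_and_mem c x
    obtain ⟨y, hy, rfl⟩ := exists_eq_pair hE hU
    exact ⟨⟨y, hy⟩, rfl⟩

end Side

/-- In a discrete space with four points, a cut amounts to the point which lies on the same side
as a given point `x`. -/
noncomputable def pairCutEquiv (hE : ENat.card E = 4) (x : E) : {y // y ≠ x} ≃ NonperipheralCut E :=
  .ofBijective _ (Side.bijective_toCut_pair hE x)

theorem exists_equiv_extending {α β : Type*} {x : α} {y : β} (τ : {a // a ≠ x} ≃ {b // b ≠ y}) :
    ∃ f : α ≃ β, f x = y ∧ ∀ a, f a.1 = τ a := by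
  classical
  exact ⟨(Equiv.optionSubtypeNe x).symm.trans
    ((Equiv.optionCongr τ).trans (Equiv.optionSubtypeNe y)), by simp, fun a => by
      simp [Equiv.optionSubtypeNe_symm_of_ne a.2]⟩

theorem exists_homeomorph_of_card_eq_four {E' : Type*} [TopologicalSpace E'] [DiscreteTopology E']
    (hE : ENat.card E = 4) (hE' : ENat.card E' = 4) (Φ : NonperipheralCut E ≃ NonperipheralCut E') :
    ∃ f : E ≃ₜ E', ∀ c, (Φ c).1 = c.1.map f := by
  obtain ⟨x⟩ := (ENat.card_ne_zero_iff_nonempty E).1 (hE ▸ four_ne_zero)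
  obtain ⟨x'⟩ := (ENat.card_ne_zero_iff_nonempty E').1 (hE' ▸ four_ne_zero)
  let τ := ((pairCutEquiv hE x).trans Φ).trans (pairCutEquiv hE' x').symm
  obtain ⟨f, hfx, hf⟩ := exists_equiv_extending τ
  let F : E ≃ₜ E' := ⟨f, continuous_of_discreteTopology, continuous_of_discreteTopology⟩
  refine ⟨F, fun c => ?_⟩
  obtain ⟨y, rfl⟩ := (pairCutEquiv hE x).surjective c
  have hΦ : Φ (pairCutEquiv hE x y) = (Side.pair hE' (τ y).2).toCut :=
    ((pairCutEquiv hE' x').apply_symm_apply _).symm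
  rw [hΦ]
  refine toCut_eq_map F fun z => ?_
  rw [Side.mem_pair, Side.mem_pair, ← hf, ← hfx]
  exact or_congr f.apply_eq_iff_eq f.apply_eq_iff_eq

end FourPoints

theorem mainTheorem2_general {E E' : Type*} [TopologicalSpace E] [CompactSpace E] [T2Space E]
    [TotallyDisconnectedSpace E] [TopologicalSpace E'] [CompactSpace E'] [T2Space E']
    [TotallyDisconnectedSpace E'] (hE : 4 ≤ ENat.card E) (Φ : cutComplex E ≃g cutComplex E') :
    ∃ f : E ≃ₜ E', ∀ c : NonperipheralCut E, (Φ c).1 = c.1.map f := by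
  obtain ⟨c⟩ := nonempty_nonperipheralCut_iff.2 hE
  have hE' : 4 ≤ ENat.card E' := nonempty_nonperipheralCut_iff.1 ⟨Φ c⟩
  have five_le_iff : 5 ≤ ENat.card E ↔ 5 ≤ ENat.card E' := by
    rw [← exists_adj_iff c, ← exists_adj_iff (Φ c), Φ.surjective.exists]
    simp only [Φ.map_adj_iff]
  by_cases h5 : 5 ≤ ENat.card E
  · obtain ⟨φ, hφ, hφΦ⟩ := exists_orderIso_of_cutComplex_iso Φ h5 (five_le_iff.1 h5)
    obtain ⟨f, hf⟩ := exists_homeomorph_of_orderIso hφ h5 (five_le_iff.1 h5)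
    refine ⟨f, fun c => ?_⟩
    obtain ⟨U, rfl⟩ := Side.toCut_surjective c
    rw [← hφΦ]
    exact toCut_eq_map f (hf U)
  · have eq_four {n : ℕ∞} (h4 : 4 ≤ n) (h5 : ¬ 5 ≤ n) : n = 4 := by
      rw [not_le] at h5
      enat_to_nat
      omega
    have h4 : ENat.card E = 4 := eq_four hE h5
    have h4' : ENat.card E' = 4 := eq_four hE' (five_le_iff.not.1 h5)
    have : Finite E := ENat.card_lt_top.1 (h4 ▸ ENat.natCast_lt_top 4)
    have : Finite E' := ENat.card_lt_top.1 (h4' ▸ ENat.natCast_lt_top 4)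
    exact exists_homeomorph_of_card_eq_four h4 h4' Φ.toEquiv

theorem mainTheorem2 {E : Type*} {E' : Type*}
    [TopologicalSpace E] [CompactSpace E] [T2Space E] [TotallyDisconnectedSpace E]
    [SecondCountableTopology E]
    [TopologicalSpace E'] [CompactSpace E'] [T2Space E'] [TotallyDisconnectedSpace E']
    [SecondCountableTopology E']
    (hE : 4 ≤ ENat.card E) (hE' : 4 ≤ ENat.card E')
    (Φ : cutComplex E ≃g cutComplex E') :
    ∃ f : E ≃ₜ E', ∀ c : NonperipheralCut E, (Φ c).1 = c.1.map f :=
  mainTheorem2_general hE Φ
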